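/- Let $D_1,D_2,\dots$ be i.i.d. with law $P$. There are finitely many candidate models; model $M$ has $p_M$ parameters, a measurable estimating function $g_M(D,\gamma)\in\mathbb R^{L}$, $\gamma\in\mathbb R^{p_M}$, and plug-in estimators $\hat\gamma_{M}=\hat\gamma_{M,n}$ (random vectors in $\mathbb R^{p_M}$). For the first $n$ observations put $$\mathrm{ELCIC}(M)=-2\log R^F(\hat\lambda_M,\hat\gamma_M)+p_M\log n,\qquad R^F(\lambda,\gamma)=\prod_{i=1}^n\{1+\lambda^{T}g_M(D_i,\gamma)\}^{-1},$$ where the Lagrange multiplier $\hat\lambda_M$ satisfies $1+\hat\lambda_M^{T}g_M(D_i,\hat\gamma_M)>0$ for all $i$ and $\frac1n\sum_{i=1}^n g_M(D_i,\hat\gamma_M)/\{1+\hat\lambda_M^{T}g_M(D_i,\hat\gamma_M)\}=0$; if there is no such multiplier, the empirical likelihood ratio at $\hat\gamma_M$ is $0$ and $\mathrm{ELCIC}(M)=+\infty$. Let $M_0$ be the true model, with true parameter $\gamma_0$; write $g=g_{M_0}$ and $\hat\gamma=\hat\gamma_{M_0}$. Assume: 1. (Regularity) $E\,g(D,\gamma_0)=0$;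 $\Sigma_{11}=E\{g(D,\gamma_0)g(D,\gamma_0)^{T}\}$ is positive definite; on a neighbourhood of $\gamma_0$, for almost every $D$, $g(D,\cdot)$ is twice continuously differentiable and $\|\partial g/\partial\gamma^{T}\|$, $\|\partial^2 g/\partial\gamma\,\partial\gamma^{T}\|$ and $\|g\|^3$ are bounded by an integrable function of $D$. 2. (Well-behaved estimator) $\hat\gamma-\gamma_0=O_p(n^{-1/2})$, and for all large $n$, $\mathrm{tr}(\Sigma_{11}^{-1}V_n)<\infty$, where $V_n=\mathrm{Cov}\{\frac1n\sum_{i=1}^n g(D_i,\gamma_0)+\Sigma_{12}(\hat\gamma-\gamma_0)\}$ and $\Sigma_{12}=E\{\partial g(D,\gamma_0)/\partial\gamma^{T}\}$. 3. Every candidate $M\neq M_0$ is of one of two kinds. Either it is misspecified: $\hat\gamma_M$ converges in probability to some $\gamma_*=\gamma_{*,M}$ such that on a neighbourhood of $\gamma_*$, for almost every $D$, $g_M(D,\cdot)$ is continuous and $\|g_M(D,\gamma)\|^{2+\delta}$ is bounded by an integrable function of $D$ for some $\delta>0$ (moments under misspecification), and $\|E\,g_M(D,\gamma)\|>0$ for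 all $\gamma$ near $\gamma_*$ (identifiability). Or it is correctly specified but larger than $M_0$: $E\,g_M(D,\gamma)=0$ for some $\gamma\in\mathbb R^{p_M}$, and $p_M>p_{M_0}$. Then ELCIC is consistent: as $n\to\infty$, $$P\big[\mathrm{ELCIC}(M)>\mathrm{ELCIC}(M_0)\ \text{for every candidate } M\neq M_0\big]\to 1 .$$ -/

import Mathlib

open MeasureTheory ProbabilityTheory Filter Topology
open scoped ENNReal RealInnerProductSpace

namespace ELCIC

noncomputable section

/-! ### Empirical likelihood at given values `x i = g (D i, γ)` of the estimating functions -/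

/-- `lam` is a Lagrange multiplier for the vectors `x 1, …, x n`: all the implied point masses
`1 / (n (1 + lamᵀ x i))` are positive and `(1/n) ∑ i, x i / (1 + lamᵀ x i) = 0`. -/
def IsMultiplier {n L : ℕ} (x : Fin n → EuclideanSpace ℝ (Fin L))
    (lam : EuclideanSpace ℝ (Fin L)) : Prop :=
  (∀ i, 0 < 1 + ⟪lam, x i⟫) ∧
    (1 / (n : ℝ)) • ∑ i, (1 + ⟪lam, x i⟫)⁻¹ • x i = 0

/-- The empirical likelihood ratio `R^F(lam, γ) = ∏ i, (1 + lamᵀ x i)⁻¹`. -/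
def elRatio {n L : ℕ} (x : Fin n → EuclideanSpace ℝ (Fin L))
    (lam : EuclideanSpace ℝ (Fin L)) : ℝ :=
  ∏ i, (1 + ⟪lam, x i⟫)⁻¹

/-- A multiplier attains the constrained maximum of `∏ i, n p_i` that defines the empirical
likelihood ratio; in particular `elRatio` has the same value at all multipliers. -/
theorem IsMultiplier.isGreatest {n L : ℕ} (hn : 0 < n)
    {x : Fin n → EuclideanSpace ℝ (Fin L)} {lam : EuclideanSpace ℝ (Fin L)}
    (h : IsMultiplier x lam) :
    IsGreatest {r : ℝ | ∃ w : Fin n → ℝ, (∀ i, 0 ≤ w i) ∧ ∑ i, w i = 1 ∧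
      ∑ i, w i • x i = 0 ∧ r = ∏ i, ((n : ℝ) * w i)} (elRatio x lam) := by
  obtain ⟨hpos, hsum⟩ := h
  have hn' : (0 : ℝ) < n := by exact_mod_cast hn
  have hs0 : ∑ i, (1 + ⟪lam, x i⟫)⁻¹ • x i = 0 := by
    rcases smul_eq_zero.1 hsum with h0 | h0
    · exact absurd h0 (by positivity)
    · exact h0
  constructor
  · refine ⟨fun i => (1 / (n : ℝ)) * (1 + ⟪lam, x i⟫)⁻¹, ?_, ?_, ?_, ?_⟩
    · intro i
      have := hpos i
      positivity
    · have e1 : ∑ i, (1 + ⟪lam, x i⟫)⁻¹ * ⟪lam, x i⟫ = 0 := by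
        have := congrArg (fun v => ⟪lam, v⟫) hs0
        simpa [inner_sum, inner_smul_right] using this
      have e2 : ∑ i, ((1 + ⟪lam, x i⟫)⁻¹ + (1 + ⟪lam, x i⟫)⁻¹ * ⟪lam, x i⟫) = (n : ℝ) := by
        have : ∀ i, (1 + ⟪lam, x i⟫)⁻¹ + (1 + ⟪lam, x i⟫)⁻¹ * ⟪lam, x i⟫ = 1 := by
          intro i
          have := (hpos i).ne'
          field_simp
        simp [this]
      rw [Finset.sum_add_distrib, e1, add_zero] at e2
      rw [← Finset.mul_sum, e2]
      field_simp
    · simp only [mul_smul, ← Finset.smul_sum, hs0, smul_zero]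
    · refine Finset.prod_congr rfl fun i _ => ?_
      field_simp
  · rintro r ⟨w, hw0, hw1, hwx, rfl⟩
    have hz : ∀ i ∈ Finset.univ, 0 ≤ ((n : ℝ) * w i) * (1 + ⟪lam, x i⟫) := fun i _ =>
      mul_nonneg (mul_nonneg hn'.le (hw0 i)) (hpos i).le
    have hsumz : ∑ i, ((n : ℝ) * w i) * (1 + ⟪lam, x i⟫) = n := by
      have e1 : ∑ i, w i * ⟪lam, x i⟫ = 0 := by
        have := congrArg (fun v => ⟪lam, v⟫) hwx
        simpa [inner_sum, inner_smul_right] using this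
      calc ∑ i, ((n : ℝ) * w i) * (1 + ⟪lam, x i⟫)
          = n * (∑ i, w i + ∑ i, w i * ⟪lam, x i⟫) := by
            rw [← Finset.sum_add_distrib, Finset.mul_sum]
            exact Finset.sum_congr rfl fun i _ => by ring
        _ = n := by rw [e1, hw1]; ring
    have am : ∏ i, ((n : ℝ) * w i) * (1 + ⟪lam, x i⟫) ≤ 1 := by
      have key := Real.geom_mean_le_arith_mean Finset.univ (fun _ => (1 : ℝ))
        (fun i => ((n : ℝ) * w i) * (1 + ⟪lam, x i⟫)) (fun _ _ => zero_le_one)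
        (by simpa using hn) hz
      simp only [Real.rpow_one, one_mul, hsumz, Finset.sum_const, Finset.card_univ,
        Fintype.card_fin, nsmul_eq_mul, mul_one, div_self hn'.ne'] at key
      have hP := Finset.prod_nonneg hz
      have := (Real.rpow_le_rpow_iff hP zero_le_one (inv_pos.2 hn')).1
        (by rw [Real.one_rpow]; exact key)
      exact this
    have hp : 0 < ∏ i, (1 + ⟪lam, x i⟫) := Finset.prod_pos fun i _ => hpos i
    rw [Finset.prod_mul_distrib] at am
    rw [elRatio, Finset.prod_inv_distrib, ← one_div, le_div_iff₀ hp]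
    exact am

open Classical in
/-- `ELCIC = -2 log R^F(lam, γ) + p log n`, with `lam` a Lagrange multiplier for the values
`x i = g (D i, γ)`. If there is no multiplier, no positive weights `w` with `∑ i, w i = 1` satisfy
`∑ i, w i • x i = 0`, the empirical likelihood ratio is `0`, and the criterion is `+∞`. -/
def elcic {n L : ℕ} (p : ℕ) (x : Fin n → EuclideanSpace ℝ (Fin L)) : EReal :=
  if h : ∃ lam, IsMultiplier x lam then
    ((-2 * Real.log (elRatio x h.choose) + p * Real.log n : ℝ) : EReal)
  else ⊤

theorem elcic_eq {n L : ℕ} (p : ℕ) {x : Fin n → EuclideanSpace ℝ (Fin L)}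
    {lam : EuclideanSpace ℝ (Fin L)} (h : IsMultiplier x lam) :
    elcic p x = ((-2 * Real.log (elRatio x lam) + p * Real.log n : ℝ) : EReal) := by
  have hex : ∃ lam, IsMultiplier x lam := ⟨lam, h⟩
  have key : elRatio x hex.choose = elRatio x lam := by
    rcases Nat.eq_zero_or_pos n with rfl | hn
    · simp [elRatio]
    · exact (hex.choose_spec.isGreatest hn).unique (h.isGreatest hn)
  rw [elcic, dif_pos hex, key]

/-! ### Moment quantities of an estimating function `g (D, γ)` when `D` has law `P` -/

section Conditions

variable {𝒟 Ω : Type*} [MeasurableSpace 𝒟] [MeasurableSpace Ω] {p L : ℕ}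

/-- `Σ₁₁ = E [g(D, γ) g(D, γ)ᵀ]`. -/
def sigma11 (P : Measure 𝒟)
    (g : 𝒟 → EuclideanSpace ℝ (Fin p) → EuclideanSpace ℝ (Fin L))
    (γ : EuclideanSpace ℝ (Fin p)) : Matrix (Fin L) (Fin L) ℝ :=
  Matrix.of fun j k => ∫ d, g d γ j * g d γ k ∂P

/-- `Σ₁₂ = E [∂g(D, γ) / ∂γᵀ]`, as a linear map. -/
def sigma12 (P : Measure 𝒟)
    (g : 𝒟 → EuclideanSpace ℝ (Fin p) → EuclideanSpace ℝ (Fin L))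
    (γ : EuclideanSpace ℝ (Fin p)) :
    EuclideanSpace ℝ (Fin p) →L[ℝ] EuclideanSpace ℝ (Fin L) :=
  ∫ d, fderiv ℝ (g d) γ ∂P

/-- The model can be correctly specified: the estimating equations have mean zero at some
parameter value. -/
def CorrectlySpecified (P : Measure 𝒟)
    (g : 𝒟 → EuclideanSpace ℝ (Fin p) → EuclideanSpace ℝ (Fin L)) : Prop :=
  ∃ γ, Integrable (fun d => g d γ) P ∧ ∫ d, g d γ ∂P = 0

/-- Regularity at the true parameter `γ₀` of a correctly specified model. -/
structure Regular (P : Measure 𝒟)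
    (g : 𝒟 → EuclideanSpace ℝ (Fin p) → EuclideanSpace ℝ (Fin L))
    (γ₀ : EuclideanSpace ℝ (Fin p)) : Prop where
  mean_zero : ∫ d, g d γ₀ ∂P = 0
  posDef : (sigma11 P g γ₀).PosDef
  smooth_dominated : ∃ U : Set (EuclideanSpace ℝ (Fin p)), IsOpen U ∧ γ₀ ∈ U ∧
    (∀ᵐ d ∂P, ContDiffOn ℝ 2 (g d) U) ∧
    ∃ G : 𝒟 → ℝ, Integrable G P ∧ ∀ᵐ d ∂P, ∀ γ ∈ U,
      ‖fderiv ℝ (g d) γ‖ ≤ G d ∧ ‖iteratedFDeriv ℝ 2 (g d) γ‖ ≤ G d ∧ ‖g d γ‖ ^ 3 ≤ G d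

/-- Regularity of a misspecified model at `γs`: near `γs` the estimating function is continuous in
the parameter and its power `2 + δ` is bounded by an integrable function (so that
`E ‖g(D, γ)‖ ^ (2 + δ) < ∞`). -/
def MisspecifiedRegular (P : Measure 𝒟)
    (g : 𝒟 → EuclideanSpace ℝ (Fin p) → EuclideanSpace ℝ (Fin L))
    (γs : EuclideanSpace ℝ (Fin p)) : Prop :=
  ∃ U : Set (EuclideanSpace ℝ (Fin p)), IsOpen U ∧ γs ∈ U ∧
    (∀ᵐ d ∂P, ContinuousOn (g d) U) ∧
    ∃ δ : ℝ, 0 < δ ∧ ∃ G : 𝒟 → ℝ, Integrable G P ∧ ∀ᵐ d ∂P, ∀ γ ∈ U,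
      ‖g d γ‖ ^ (2 + δ) ≤ G d

/-- Identifiability: the mean of the estimating equations does not vanish near `γs`. -/
def Identifiable (P : Measure 𝒟)
    (g : 𝒟 → EuclideanSpace ℝ (Fin p) → EuclideanSpace ℝ (Fin L))
    (γs : EuclideanSpace ℝ (Fin p)) : Prop :=
  ∀ᶠ γ in 𝓝 γs, 0 < ‖∫ d, g d γ ∂P‖

/-- `X n = O_p(1)`. -/
def BoundedInProbability (μ : Measure Ω) (X : ℕ → Ω → ℝ) : Prop :=
  ∀ ε : ℝ≥0∞, 0 < ε → ∃ C : ℝ, ∀ᶠ n in atTop, μ {ω | C < |X n ω|} ≤ ε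

/-- `tr (S⁻¹ Cov Q)` for a random vector `Q`, written as the expectation
`E [(Q - E Q)ᵀ S⁻¹ (Q - E Q)]` with values in `[0, ∞]`. -/
def traceInvCov (μ : Measure Ω) (S : Matrix (Fin L) (Fin L) ℝ)
    (Q : Ω → EuclideanSpace ℝ (Fin L)) : ℝ≥0∞ :=
  ∫⁻ ω, ENNReal.ofReal
    (∑ j, ∑ k, S⁻¹ j k * ((Q ω k - ∫ ω', Q ω' k ∂μ) * (Q ω j - ∫ ω', Q ω' j ∂μ))) ∂μ

theorem traceInvCov_eq (μ : Measure Ω) [IsProbabilityMeasure μ] {S : Matrix (Fin L) (Fin L) ℝ}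
    (hS : S.PosDef) {Q : Ω → EuclideanSpace ℝ (Fin L)} (hQ : ∀ j, MemLp (fun ω => Q ω j) 2 μ) :
    traceInvCov μ S Q = ENNReal.ofReal
      ((S⁻¹ * Matrix.of fun j k => cov[fun ω => Q ω j, fun ω => Q ω k; μ]).trace) := by
  have hc : ∀ j, MemLp (fun ω => Q ω j - ∫ ω', Q ω' j ∂μ) 2 μ := fun j =>
    (hQ j).sub (memLp_const _)
  have hint : ∀ j k, Integrable (fun ω => S⁻¹ j k *
      ((Q ω k - ∫ ω', Q ω' k ∂μ) * (Q ω j - ∫ ω', Q ω' j ∂μ))) μ := fun j k =>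
    ((hc k).integrable_mul (hc j)).const_mul _
  rw [traceInvCov, ← ofReal_integral_eq_lintegral_ofReal]
  · congr 1
    rw [integral_finsetSum _ fun j _ => integrable_finsetSum _ fun k _ => hint j k]
    simp only [Matrix.trace, Matrix.diag, Matrix.mul_apply, Matrix.of_apply, covariance]
    refine Finset.sum_congr rfl fun j _ => ?_
    rw [integral_finsetSum _ fun k _ => hint j k]
    exact Finset.sum_congr rfl fun k _ => integral_const_mul _ _
  · exact integrable_finsetSum _ fun j _ => integrable_finsetSum _ fun k _ => hint j k
  · refine Filter.Eventually.of_forall fun ω => ?_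
    have h := hS.inv.posSemidef.dotProduct_mulVec_nonneg
      (fun j => Q ω j - ∫ ω', Q ω' j ∂μ)
    simp only [dotProduct, Matrix.mulVec, Finset.mul_sum, star_trivial, Pi.star_apply] at h
    refine h.trans (le_of_eq ?_)
    exact Finset.sum_congr rfl fun j _ => Finset.sum_congr rfl fun k _ => by ring

/-- The vector `(1/n) ∑ i, g(D i, γ₀) + Σ₁₂ (γhat - γ₀)`. -/
def Qn (P : Measure 𝒟)
    (g : 𝒟 → EuclideanSpace ℝ (Fin p) → EuclideanSpace ℝ (Fin L))
    (γ₀ : EuclideanSpace ℝ (Fin p)) (D : ℕ → Ω → 𝒟)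
    (γhat : ℕ → Ω → EuclideanSpace ℝ (Fin p)) (n : ℕ) (ω : Ω) : EuclideanSpace ℝ (Fin L) :=
  (1 / (n : ℝ)) • ∑ i : Fin n, g (D i ω) γ₀ + sigma12 P g γ₀ (γhat n ω - γ₀)

/-- Well-behaved plug-in estimator for a correctly specified model with true parameter `γ₀`:
`γhat - γ₀ = O_p(n^{-1/2})` and, from some `n` on,
`tr (Σ₁₁⁻¹ Cov((1/n) ∑ i, g(D i, γ₀) + Σ₁₂ (γhat - γ₀))) < ∞`. -/
structure WellBehaved (P : Measure 𝒟) (μ : Measure Ω)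
    (g : 𝒟 → EuclideanSpace ℝ (Fin p) → EuclideanSpace ℝ (Fin L))
    (γ₀ : EuclideanSpace ℝ (Fin p)) (D : ℕ → Ω → 𝒟)
    (γhat : ℕ → Ω → EuclideanSpace ℝ (Fin p)) : Prop where
  root_n : BoundedInProbability μ fun n ω => √(n : ℝ) * ‖γhat n ω - γ₀‖
  trace_finite : ∀ᶠ n in atTop,
    traceInvCov μ (sigma11 P g γ₀) (Qn P g γ₀ D γhat n) < ∞

end Conditions

end

end ELCIC

/-!
Write `f(lam) = ∑ i, log (1 + lamᵀ x i)` for the dual objective, so that `-2 log R^F = 2 f(lam)`.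

*Duality.* A multiplier maximizes `f` (`IsMultiplier.sum_log_le`). Hence every admissible `ν` gives
the lower bound `2 f(ν) + p log n ≤ ELCIC` (`le_elcic`), and `ν = 0` gives `p log n ≤ ELCIC`
whatever the model.

*True model.* On a ball of radius of the order `1 / max ‖x i‖` the function `f` is bounded by
`n (m ‖lam‖ - c ‖lam‖² / 4)`, where `m` bounds the norm of the sample mean and `c` the second moment
matrix from below. If `m` is small compared with the radius, the maximum over the ball is interior,
which produces a multiplier with `f ≤ n m² / c` (`exists_isMultiplier`). Here `m = O_p(n^{-1/2})`
by Chebyshev's inequality and the mean value inequality, and `max ‖x i‖ ≤ n^{1/3}` with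
probability tending to one by the third moment, so the log likelihood ratio is `O_p(1)`
(`Regular.exists_eventually_whp_isMultiplier`) and ELCIC is below `(p + 1) log n`. A larger
correctly specified model has ELCIC at least `(p + 1) log n`.

*Misspecified model.* The sample mean tends to some `v ≠ 0`, by a law of large numbers that is
locally uniform in the parameter (`eventually_whp_norm_average_plugin_sub_lt`). Taking for `ν` the
multiple of `v` of length `n^{-1/(2+δ)} / 8` keeps all `|νᵀ x i|` below `1 / 8`, since
`max ‖x i‖ ≤ n^{1/(2+δ)}` with probability tending to one, and makes `f(ν)` at least of the order
`n^{1 - 1/(2+δ)}`, which exceeds every multiple of `log n`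
(`MisspecifiedRegular.eventually_whp_mul_log_lt`).

Statements holding with probability tending to one are expressed through the filter `whp μ`, so
that finitely many of them can be combined.
-/

namespace ELCIC

/-! ### The empirical likelihood ratio of a fixed sample -/

section Deterministic

variable {n L : ℕ} {x : Fin n → EuclideanSpace ℝ (Fin L)} {lam ν : EuclideanSpace ℝ (Fin L)}

theorem sub_sq_le_log_one_add {y : ℝ} (hy : |y| ≤ 1 / 8) : y - y ^ 2 ≤ Real.log (1 + y) := by
  have h := Real.abs_log_sub_add_sum_range_le (x := -y) (by rw [abs_neg]; linarith) 2
  have h1 : |-y| ^ (2 + 1) / (1 - |-y|) ≤ y ^ 2 / 4 := by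
    rw [abs_neg, div_le_iff₀ (by linarith), pow_succ, sq_abs]
    nlinarith [sq_nonneg y, abs_nonneg y]
  have h2 := neg_le_of_abs_le (h.trans h1)
  norm_num [Finset.sum_range_succ] at h2
  nlinarith [sq_nonneg y]

theorem log_one_add_le {y : ℝ} (hy : |y| ≤ 1 / 8) : Real.log (1 + y) ≤ y - y ^ 2 / 4 := by
  have h := Real.abs_log_sub_add_sum_range_le (x := -y) (by rw [abs_neg]; linarith) 2
  have h1 : |-y| ^ (2 + 1) / (1 - |-y|) ≤ y ^ 2 / 4 := by
    rw [abs_neg, div_le_iff₀ (by linarith), pow_succ, sq_abs]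
    nlinarith [sq_nonneg y, abs_nonneg y]
  have h2 := le_of_abs_le (h.trans h1)
  norm_num [Finset.sum_range_succ] at h2
  linarith

theorem log_elRatio (h : ∀ i, 0 < 1 + ⟪lam, x i⟫) :
    Real.log (elRatio x lam) = -∑ i, Real.log (1 + ⟪lam, x i⟫) := by
  rw [elRatio, Real.log_prod fun i _ => inv_ne_zero (h i).ne', ← Finset.sum_neg_distrib]
  exact Finset.sum_congr rfl fun i _ => Real.log_inv _

theorem IsMultiplier.sum_eq_zero (h : IsMultiplier x lam) :
    ∑ i, (1 + ⟪lam, x i⟫)⁻¹ • x i = 0 := by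
  rcases smul_eq_zero.1 h.2 with h0 | h0
  · have : n = 0 := by simpa using h0
    subst this
    simp
  · exact h0

/-- A multiplier maximizes `ν ↦ ∑ i, log (1 + νᵀ x i)`; this is the dual description of the
empirical likelihood ratio. The inequality is `log a ≤ a - 1` at the quotients
`(1 + νᵀ x i) / (1 + lamᵀ x i)`. -/
theorem IsMultiplier.sum_log_le (h : IsMultiplier x lam) (hν : ∀ i, 0 < 1 + ⟪ν, x i⟫) :
    ∑ i, Real.log (1 + ⟪ν, x i⟫) ≤ ∑ i, Real.log (1 + ⟪lam, x i⟫) := by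
  have e : ∑ i, (1 + ⟪lam, x i⟫)⁻¹ * ⟪ν - lam, x i⟫ = 0 := by
    have := congrArg (fun v => ⟪ν - lam, v⟫) h.sum_eq_zero
    simpa only [inner_sum, inner_smul_right, inner_zero_right] using this
  have key : ∀ i, Real.log (1 + ⟪ν, x i⟫) - Real.log (1 + ⟪lam, x i⟫) ≤
      (1 + ⟪lam, x i⟫)⁻¹ * ⟪ν - lam, x i⟫ := by
    intro i
    have hl := h.1 i
    rw [← Real.log_div (hν i).ne' hl.ne']
    refine (Real.log_le_sub_one_of_pos (div_pos (hν i) hl)).trans (le_of_eq ?_)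
    rw [inner_sub_left]
    field_simp
    ring
  have := Finset.sum_le_sum fun i (_ : i ∈ Finset.univ) => key i
  rw [e, Finset.sum_sub_distrib] at this
  linarith

/-- Any admissible `ν`, whether or not it is a multiplier, bounds the criterion from below. -/
theorem le_elcic (p : ℕ) (hν : ∀ i, 0 < 1 + ⟪ν, x i⟫) :
    ((2 * ∑ i, Real.log (1 + ⟪ν, x i⟫) + p * Real.log n : ℝ) : EReal) ≤ elcic p x := by
  by_cases h : ∃ lam, IsMultiplier x lam
  · obtain ⟨lam, h⟩ := h
    rw [elcic_eq p h, EReal.coe_le_coe_iff, log_elRatio h.1]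
    have := h.sum_log_le hν
    linarith
  · rw [elcic, dif_neg h]
    exact le_top

theorem mul_log_le_elcic (p : ℕ) (x : Fin n → EuclideanSpace ℝ (Fin L)) :
    ((p * Real.log n : ℝ) : EReal) ≤ elcic p x := by
  simpa using le_elcic (x := x) (ν := 0) p (by simp)

/-- Existence of a multiplier, with a bound on the log likelihood ratio, when the mean of the
sample is small and its second moment matrix is bounded below by `c`. On the ball of radius `ρ`
all `lamᵀ x i` are at most `1 / 8` in absolute value, so the dual objective is at most
`n (m ‖lam‖ - c ‖lam‖² / 4)`. This is negative on the sphere, and `0` is the value at the origin;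
hence the maximum over the ball is attained in the interior and is a critical point. -/
theorem exists_isMultiplier (hn : 0 < n) {c m ρ : ℝ} (hc : 0 < c) (hρ : 0 < ρ)
    (hx : ∀ i, ρ * ‖x i‖ ≤ 1 / 8) (hm : ‖∑ i, x i‖ ≤ n * m)
    (hS : ∀ u, n * (c * ‖u‖ ^ 2) ≤ ∑ i, ⟪u, x i⟫ ^ 2) (hlt : 4 * m < c * ρ) :
    ∃ lam, IsMultiplier x lam ∧ ∑ i, Real.log (1 + ⟪lam, x i⟫) ≤ n * (m ^ 2 / c) := by
  have hn' : (0 : ℝ) < n := by exact_mod_cast hn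
  set f : EuclideanSpace ℝ (Fin L) → ℝ := fun lam => ∑ i, Real.log (1 + ⟪lam, x i⟫) with hf
  have hin : ∀ u ∈ Metric.closedBall (0 : EuclideanSpace ℝ (Fin L)) ρ, ∀ i,
      |⟪u, x i⟫| ≤ 1 / 8 := by
    intro u hu i
    rw [mem_closedBall_zero_iff] at hu
    refine (abs_real_inner_le_norm u (x i)).trans (le_trans ?_ (hx i))
    gcongr
  have hpos : ∀ u ∈ Metric.closedBall (0 : EuclideanSpace ℝ (Fin L)) ρ, ∀ i,
      0 < 1 + ⟪u, x i⟫ := by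
    intro u hu i
    have := neg_le_of_abs_le (hin u hu i)
    linarith
  have hfle : ∀ u ∈ Metric.closedBall (0 : EuclideanSpace ℝ (Fin L)) ρ,
      f u ≤ n * (‖u‖ * m - c * ‖u‖ ^ 2 / 4) := by
    intro u hu
    have h1 : f u ≤ ∑ i, (⟪u, x i⟫ - ⟪u, x i⟫ ^ 2 / 4) :=
      Finset.sum_le_sum fun i _ => log_one_add_le (hin u hu i)
    rw [Finset.sum_sub_distrib, ← inner_sum, ← Finset.sum_div] at h1
    have h2 : ⟪u, ∑ i, x i⟫ ≤ ‖u‖ * (n * m) :=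
      (real_inner_le_norm _ _).trans (by gcongr)
    have h3 := hS u
    linarith
  have hd : ∀ u ∈ Metric.closedBall (0 : EuclideanSpace ℝ (Fin L)) ρ,
      HasFDerivAt f (∑ i, (1 + ⟪u, x i⟫)⁻¹ • innerSL ℝ (x i)) u := by
    intro u hu
    refine HasFDerivAt.fun_sum fun i _ => ?_
    have h1 : HasFDerivAt (fun u => 1 + ⟪u, x i⟫) (innerSL ℝ (x i)) u := by
      have := ((innerSL ℝ (x i)).hasFDerivAt (x := u)).const_add 1
      refine this.congr_of_eventuallyEq (Eventually.of_forall fun v => ?_)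
      simp [real_inner_comm]
    exact h1.log (hpos u hu i).ne'
  obtain ⟨lam, hlam, hmax⟩ := (isCompact_closedBall (0 : EuclideanSpace ℝ (Fin L)) ρ).exists_isMaxOn
    ⟨0, by simp [hρ.le]⟩ fun u hu => (hd u hu).continuousAt.continuousWithinAt
  have hf0 : 0 ≤ f lam := by
    have := hmax (show (0 : EuclideanSpace ℝ (Fin L)) ∈ Metric.closedBall 0 ρ by simp [hρ.le])
    simpa [hf] using this
  have hint : ‖lam‖ < ρ := by
    refine lt_of_le_of_ne (mem_closedBall_zero_iff.1 hlam) fun he => ?_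
    have h1 := hf0.trans (hfle lam hlam)
    rw [he] at h1
    have h2 := nonneg_of_mul_nonneg_right h1 hn'
    have h3 : ρ * (4 * m) < ρ * (c * ρ) := by gcongr
    nlinarith
  refine ⟨lam, ⟨hpos lam hlam, ?_⟩, ?_⟩
  · have hloc : IsLocalMax f lam := hmax.isLocalMax
      (Metric.closedBall_mem_nhds_of_mem (mem_ball_zero_iff.2 hint))
    have hz := hloc.hasFDerivAt_eq_zero (hd lam hlam)
    have : ∑ i, (1 + ⟪lam, x i⟫)⁻¹ • x i = 0 := by
      refine ext_inner_right ℝ fun v => ?_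
      have := congrArg (fun T => T v) hz
      simpa [sum_inner, inner_smul_left] using this
    rw [this, smul_zero]
  · refine (hfle lam hlam).trans ?_
    gcongr
    rw [le_div_iff₀ hc]
    nlinarith [sq_nonneg (c * ‖lam‖ / 2 - m)]

end Deterministic

/-! ### Events of probability tending to one -/

section HighProbability

variable {Ω : Type*} [MeasurableSpace Ω] {μ : Measure Ω}

/-- The filter of sequences of events whose probability tends to one: `∀ᶠ z in whp μ, p z.1 z.2`
says that the (outer) measure of the failure set `{ω | ¬ p n ω}` tends to `0` as `n → ∞`.
No measurability is asked of the events. -/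
def whp (μ : Measure Ω) : Filter (ℕ × Ω) where
  sets := {s | Tendsto (fun n => μ {ω | (n, ω) ∉ s}) atTop (𝓝 0)}
  univ_sets := by simp
  sets_of_superset := fun {s t} hs hst =>
    tendsto_of_tendsto_of_tendsto_of_le_of_le tendsto_const_nhds hs (fun _ => zero_le)
      fun n => measure_mono fun ω hω h => hω (hst h)
  inter_sets := fun {s t} hs ht => by
    have h := Tendsto.add (show Tendsto _ _ _ from hs) (show Tendsto _ _ _ from ht)
    rw [add_zero] at h
    refine tendsto_of_tendsto_of_tendsto_of_le_of_le tendsto_const_nhds h (fun _ => zero_le)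
      fun n => (measure_mono ?_).trans (measure_union_le _ _)
    intro ω hω
    by_contra hc
    simp only [Set.mem_union, Set.mem_ofPred_eq, not_or, not_not] at hc
    exact hω hc

theorem eventually_whp {p : ℕ × Ω → Prop} :
    (∀ᶠ z in whp μ, p z) ↔ Tendsto (fun n => μ {ω | ¬ p (n, ω)}) atTop (𝓝 0) := Iff.rfl

theorem eventually_whp_of_atTop {p : ℕ → Prop} (h : ∀ᶠ n in atTop, p n) :
    ∀ᶠ z in whp μ, p z.1 := by
  rw [eventually_whp]
  refine tendsto_const_nhds.congr' ?_
  filter_upwards [h] with n hn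
  simp [hn]

theorem eventually_whp_of_ae {p : ℕ → Ω → Prop} (h : ∀ n, ∀ᵐ ω ∂μ, p n ω) :
    ∀ᶠ z in whp μ, p z.1 z.2 := by
  rw [eventually_whp]
  refine tendsto_const_nhds.congr fun n => ?_
  exact (ae_iff.1 (h n)).symm

/-- It is enough that the failure probability is eventually at most every `ε > 0`. -/
theorem eventually_whp_of_le {p : ℕ → Ω → Prop}
    (h : ∀ ε : ℝ≥0∞, 0 < ε → ∀ᶠ n in atTop, μ {ω | ¬ p n ω} ≤ ε) :
    ∀ᶠ z in whp μ, p z.1 z.2 := by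
  rw [eventually_whp, ENNReal.tendsto_nhds_zero]
  exact h

theorem eventually_whp_of_tendstoInMeasure {E : Type*} [PseudoMetricSpace E] {f : ℕ → Ω → E}
    {g : Ω → E} (h : TendstoInMeasure μ f atTop g) {ε : ℝ} (hε : 0 < ε) :
    ∀ᶠ z in whp μ, dist (f z.1 z.2) (g z.2) < ε := by
  rw [eventually_whp]
  refine (h (ENNReal.ofReal ε) (by simpa using hε)).congr fun n => ?_
  congr 1
  ext ω
  simp only [Set.mem_ofPred_eq, not_lt, edist_dist]
  rw [ENNReal.ofReal_le_ofReal_iff dist_nonneg]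

theorem BoundedInProbability.eventually_whp {X : ℕ → Ω → ℝ} (h : BoundedInProbability μ X)
    {a : ℕ → ℝ} (ha : Tendsto a atTop atTop) : ∀ᶠ z in whp μ, |X z.1 z.2| ≤ a z.1 := by
  refine eventually_whp_of_le (p := fun n ω => |X n ω| ≤ a n) fun ε hε => ?_
  obtain ⟨C, hC⟩ := h ε hε
  filter_upwards [hC, ha.eventually_ge_atTop C] with n h1 h2
  refine le_trans (measure_mono fun ω hω => ?_) h1
  exact h2.trans_lt (not_le.1 hω)

theorem tendsto_measure_one_of_eventually_whp [IsProbabilityMeasure μ] {p : ℕ × Ω → Prop}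
    (h : ∀ᶠ z in whp μ, p z) : Tendsto (fun n => μ {ω | p (n, ω)}) atTop (𝓝 1) := by
  have h1 : Tendsto (fun n => 1 - μ {ω | ¬ p (n, ω)}) atTop (𝓝 1) := by
    simpa using ENNReal.Tendsto.sub (tendsto_const_nhds (x := (1 : ℝ≥0∞)))
      (eventually_whp.1 h) (Or.inl ENNReal.one_ne_top)
  refine tendsto_of_tendsto_of_tendsto_of_le_of_le h1 tendsto_const_nhds (fun n => ?_)
    fun n => prob_le_one
  rw [tsub_le_iff_right, ← measure_univ (μ := μ)]
  refine (measure_mono fun ω _ => ?_).trans (measure_union_le _ _)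
  exact em (p (n, ω))

end HighProbability

/-! ### Sample averages and maxima of independent observations -/

section Sample

variable {𝒟 Ω : Type*} [MeasurableSpace 𝒟] [MeasurableSpace Ω] {μ : Measure Ω} {P : Measure 𝒟}
  {D : ℕ → Ω → 𝒟}

theorem eventually_whp_forall_of_ae (hD : ∀ i, HasLaw (D i) P μ) {q : 𝒟 → Prop}
    (hq : ∀ᵐ d ∂P, q d) : ∀ᶠ z in whp μ, ∀ i : Fin z.1, q (D i z.2) := by
  refine eventually_whp_of_ae (p := fun n ω => ∀ i : Fin n, q (D i ω)) fun n => ?_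
  refine ae_all_iff.2 fun i => ae_of_ae_map (hD i).aemeasurable ?_
  rwa [(hD i).map_eq]

/-- The weak law of large numbers. -/
theorem eventually_whp_norm_average_sub_lt [IsProbabilityMeasure μ] {E : Type*}
    [NormedAddCommGroup E] [NormedSpace ℝ E] [CompleteSpace E] [MeasurableSpace E] [BorelSpace E]
    (hD : ∀ i, HasLaw (D i) P μ) (hind : iIndepFun D μ) {φ : 𝒟 → E} (hφ : Integrable φ P)
    {ε : ℝ} (hε : 0 < ε) :
    ∀ᶠ z in whp μ, ‖(z.1 : ℝ)⁻¹ • ∑ i : Fin z.1, φ (D i z.2) - ∫ d, φ d ∂P‖ < ε := by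
  have hm : ∀ i, AEMeasurable φ (μ.map (D i)) := fun i => by
    rw [(hD i).map_eq]; exact hφ.aemeasurable
  have hint : ∀ i, Integrable (fun ω => φ (D i ω)) μ := fun i => by
    refine Integrable.comp_aemeasurable (f := D i) ?_ (hD i).aemeasurable
    rwa [(hD i).map_eq]
  have hlaw : ∀ i, IdentDistrib (D i) (D 0) μ μ := fun i => (hD i).identDistrib (hD 0)
  have hae := strong_law_ae (fun i ω => φ (D i ω)) (hint 0)
    (fun i j hij => (hind.indepFun hij).comp₀ (hD i).aemeasurable (hD j).aemeasurable
      (hm i) (hm j)) (fun i => (hlaw i).comp_of_aemeasurable (hm i))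
  have hmean : ∫ ω, φ (D 0 ω) ∂μ = ∫ d, φ d ∂P :=
    (hD 0).integral_comp hφ.aestronglyMeasurable
  have := eventually_whp_of_tendstoInMeasure (tendstoInMeasure_of_tendsto_ae (fun n =>
    (Finset.aestronglyMeasurable_fun_sum _ fun i _ =>
      (hint i).aestronglyMeasurable).fun_const_smul ((n : ℝ)⁻¹)) hae) hε
  refine this.mono fun z hz => ?_
  rw [dist_eq_norm, hmean, Finset.sum_range] at hz
  exact hz

/-- The maximum of `n` independent copies of an integrable variable is at most `n` with
probability tending to one: `n P(φ ≥ n) ≤ E[φ; φ ≥ n] → 0`. -/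
theorem eventually_whp_forall_le [IsFiniteMeasure P] (hD : ∀ i, HasLaw (D i) P μ) {φ : 𝒟 → ℝ}
    (hφ : Integrable φ P) : ∀ᶠ z in whp μ, ∀ i : Fin z.1, φ (D i z.2) ≤ z.1 := by
  have hfin : ∫⁻ d, ‖φ d‖ₑ ∂P ≠ ∞ := hφ.hasFiniteIntegral.ne
  have hs : Tendsto (fun n : ℕ => P {d | (n : ℝ≥0∞) ≤ ‖φ d‖ₑ}) atTop (𝓝 0) := by
    have h1 : Tendsto (fun n : ℕ => (∫⁻ d, ‖φ d‖ₑ ∂P) / n) atTop (𝓝 0) :=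
      ENNReal.Tendsto.const_div ENNReal.tendsto_nat_nhds_top (Or.inr hfin) |>.trans (by simp)
    refine tendsto_of_tendsto_of_tendsto_of_le_of_le' tendsto_const_nhds h1
      (Eventually.of_forall fun _ => zero_le) ?_
    filter_upwards [eventually_gt_atTop 0] with n hn
    exact meas_ge_le_lintegral_div hφ.aemeasurable.enorm (by simpa using hn.ne') (by simp)
  have h := tendsto_setLIntegral_zero hfin hs
  rw [eventually_whp]
  refine tendsto_of_tendsto_of_tendsto_of_le_of_le tendsto_const_nhds h (fun _ => zero_le)
    fun n => ?_
  have hnm : NullMeasurableSet {d | (n : ℝ≥0∞) ≤ ‖φ d‖ₑ} P :=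
    nullMeasurableSet_le aemeasurable_const hφ.aemeasurable.enorm
  calc μ {ω | ¬ ∀ i : Fin n, φ (D i ω) ≤ n}
      ≤ μ (⋃ i : Fin n, D i ⁻¹' {d | (n : ℝ≥0∞) ≤ ‖φ d‖ₑ}) := by
        refine measure_mono fun ω hω => ?_
        simp only [Set.mem_ofPred_eq, not_forall, not_le] at hω
        obtain ⟨i, hi⟩ := hω
        refine Set.mem_iUnion.2 ⟨i, ?_⟩
        simp only [Set.mem_preimage, Set.mem_ofPred_eq]
        rw [Real.enorm_eq_ofReal_abs, ← ENNReal.ofReal_natCast]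
        exact ENNReal.ofReal_le_ofReal (hi.le.trans (le_abs_self _))
    _ ≤ ∑ i : Fin n, μ (D i ⁻¹' {d | (n : ℝ≥0∞) ≤ ‖φ d‖ₑ}) := measure_iUnion_fintype_le _ _
    _ = n * P {d | (n : ℝ≥0∞) ≤ ‖φ d‖ₑ} := by
        have : ∀ i : Fin n, μ (D i ⁻¹' {d | (n : ℝ≥0∞) ≤ ‖φ d‖ₑ}) =
            P {d | (n : ℝ≥0∞) ≤ ‖φ d‖ₑ} := fun i => by
          rw [← (hD i).map_eq, Measure.map_apply₀ (hD i).aemeasurable]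
          rwa [(hD i).map_eq]
        rw [Finset.sum_congr rfl fun i _ => this i]
        simp
    _ ≤ ∫⁻ d in {d | (n : ℝ≥0∞) ≤ ‖φ d‖ₑ}, ‖φ d‖ₑ ∂P := by
        rw [← setLIntegral_const]
        exact lintegral_mono_ae (ae_restrict_mem₀ hnm)

/-- Chebyshev's inequality: the sum of `n` independent centred copies of a square integrable
variable is `O_p(√n)`. -/
theorem eventually_whp_abs_sum_le [IsProbabilityMeasure μ] (hD : ∀ i, HasLaw (D i) P μ)
    (hind : iIndepFun D μ) {φ : 𝒟 → ℝ} (hφ : MemLp φ 2 P) (h0 : ∫ d, φ d ∂P = 0)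
    {a : ℕ → ℝ} (ha : Tendsto a atTop atTop) :
    ∀ᶠ z in whp μ, |∑ i : Fin z.1, φ (D i z.2)| ≤ a z.1 * √z.1 := by
  have hm : ∀ i, AEMeasurable φ (μ.map (D i)) := fun i => by
    rw [(hD i).map_eq]; exact hφ.aestronglyMeasurable.aemeasurable
  have hL : ∀ i, MemLp (fun ω => φ (D i ω)) 2 μ := fun i => by
    refine MemLp.comp_of_map ?_ (hD i).aemeasurable
    rwa [(hD i).map_eq]
  have hvar : ∀ i, Var[fun ω => φ (D i ω); μ] = Var[φ; P] := fun i => by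
    rw [← (hD i).map_eq, variance_map (hm i) (hD i).aemeasurable]
    rfl
  have hmean : ∀ i, ∫ ω, φ (D i ω) ∂μ = 0 := fun i =>
    ((hD i).integral_comp hφ.aestronglyMeasurable).trans h0
  have hlim : Tendsto (fun n => ENNReal.ofReal (Var[φ; P] / a n ^ 2)) atTop (𝓝 0) := by
    have : Tendsto (fun n => Var[φ; P] / a n ^ 2) atTop (𝓝 0) :=
      ((tendsto_pow_atTop two_ne_zero).comp ha).const_div_atTop _
    simpa using ENNReal.tendsto_ofReal this
  rw [eventually_whp]
  refine tendsto_of_tendsto_of_tendsto_of_le_of_le' tendsto_const_nhds hlim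
    (Eventually.of_forall fun _ => zero_le) ?_
  filter_upwards [ha.eventually_gt_atTop 0, eventually_gt_atTop 0] with n han hn
  have hn' : (0 : ℝ) < n := by exact_mod_cast hn
  have hsq : 0 < √(n : ℝ) := Real.sqrt_pos.2 hn'
  have hsum : MemLp (∑ i : Fin n, fun ω => φ (D i ω)) 2 μ :=
    memLp_finsetSum' _ fun i _ => hL i
  have hV : Var[∑ i : Fin n, fun ω => φ (D i ω); μ] = n * Var[φ; P] := by
    rw [IndepFun.variance_sum (fun (i : Fin n) _ => hL i)]
    · simp [hvar]
    · intro i _ j _ hij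
      exact (hind.indepFun fun h => hij (Fin.ext h)).comp₀ (hD i).aemeasurable
        (hD j).aemeasurable (hm i) (hm j)
  have hE : μ[∑ i : Fin n, fun ω => φ (D i ω)] = 0 := by
    simp only [Finset.sum_apply]
    rw [integral_finsetSum _ fun (i : Fin n) _ => (hL i).integrable one_le_two]
    simp [hmean]
  have h := meas_ge_le_variance_div_sq hsum (mul_pos han hsq)
  rw [hV, hE, mul_pow, Real.sq_sqrt hn'.le, mul_comm (n : ℝ), mul_div_mul_right _ _ hn'.ne'] at h
  refine le_trans (measure_mono fun ω hω => ?_) h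
  simp only [Set.mem_ofPred_eq, not_le] at hω
  simpa using hω.le

end Sample

/-! ### The criterion of the true model -/

section TrueModel

variable {𝒟 Ω : Type*} [MeasurableSpace 𝒟] [MeasurableSpace Ω] {μ : Measure Ω} {P : Measure 𝒟}
  {D : ℕ → Ω → 𝒟} {p L : ℕ}

/-- A multiplier exists for a sample `x` close to a sample `y` whose mean is small and whose
second moment matrix is bounded below by `c`; half of that lower bound pays for the passage from
`y` to `x`. -/
theorem exists_isMultiplier_of_close {n : ℕ} (hn : 0 < n)
    {x y : Fin n → EuclideanSpace ℝ (Fin L)} {w : Fin n → ℝ} {b c m B θ : ℝ} (hb : 0 < b)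
    (hc : 0 < c) (hθ : 0 ≤ θ) (hx : ∀ i, ‖x i‖ ≤ b) (hy : ∀ i, ‖y i‖ ≤ b)
    (hxy : ∀ i, ‖x i - y i‖ ≤ w i * θ) (hw : ∑ i, w i ≤ n * B) (hm : ‖∑ i, y i‖ ≤ n * m)
    (hS : ∀ u, n * (c * ‖u‖ ^ 2) ≤ ∑ i, ⟪u, y i⟫ ^ 2) (hlt : 128 * (b * (m + B * θ)) < c) :
    ∃ lam, IsMultiplier x lam ∧
      ∑ i, Real.log (1 + ⟪lam, x i⟫) ≤ n * ((m + B * θ) ^ 2 / (c / 4)) := by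
  have hn' : (0 : ℝ) < n := by exact_mod_cast hn
  have hm0 : 0 ≤ m := nonneg_of_mul_nonneg_right ((norm_nonneg _).trans hm) hn'
  have hwθ : ∑ i, ‖x i - y i‖ ≤ n * (B * θ) := by
    refine (Finset.sum_le_sum fun i _ => hxy i).trans ?_
    rw [← Finset.sum_mul, ← mul_assoc]
    gcongr
  have hbm : 0 ≤ b * m := by positivity
  refine exists_isMultiplier hn (by positivity) (ρ := b⁻¹ / 8) (by positivity) (fun i => ?_) ?_
    (fun u => ?_) ?_
  · calc b⁻¹ / 8 * ‖x i‖ ≤ b⁻¹ / 8 * b := by gcongr; exact hx i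
      _ = 1 / 8 := by field_simp
  · have : ∑ i, x i = ∑ i, y i + ∑ i, (x i - y i) := by
      rw [Finset.sum_sub_distrib]; abel
    rw [this]
    refine (norm_add_le _ _).trans ?_
    have := (norm_sum_le Finset.univ fun i => x i - y i).trans hwθ
    linarith
  · have h1 : ∑ i, (⟪u, y i⟫ ^ 2 / 2 - ‖u‖ ^ 2 * (2 * b) * ‖x i - y i‖) ≤ ∑ i, ⟪u, x i⟫ ^ 2 := by
      refine Finset.sum_le_sum fun i _ => ?_
      have e : ⟪u, x i⟫ = ⟪u, y i⟫ + ⟪u, x i - y i⟫ := by rw [← inner_add_right]; congr 1; abel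
      have h2 : ⟪u, x i - y i⟫ ^ 2 ≤ ‖u‖ ^ 2 * (2 * b) * ‖x i - y i‖ := by
        have h3 : |⟪u, x i - y i⟫| ≤ ‖u‖ * ‖x i - y i‖ := abs_real_inner_le_norm _ _
        have h4 : ‖x i - y i‖ ≤ 2 * b := (norm_sub_le _ _).trans (by linarith [hx i, hy i])
        calc ⟪u, x i - y i⟫ ^ 2 = |⟪u, x i - y i⟫| ^ 2 := (sq_abs _).symm
          _ ≤ (‖u‖ * ‖x i - y i‖) ^ 2 := by gcongr
          _ = ‖u‖ ^ 2 * ‖x i - y i‖ * ‖x i - y i‖ := by ring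
          _ ≤ ‖u‖ ^ 2 * (2 * b) * ‖x i - y i‖ := by gcongr
      rw [e]
      nlinarith [sq_nonneg (⟪u, y i⟫ + 2 * ⟪u, x i - y i⟫)]
    rw [Finset.sum_sub_distrib, ← Finset.sum_div, ← Finset.mul_sum] at h1
    have h2 := hS u
    have h3 : ‖u‖ ^ 2 * (2 * b) * ∑ i, ‖x i - y i‖ ≤ ‖u‖ ^ 2 * (2 * b) * (n * (B * θ)) := by
      gcongr
    have h4 : n * ‖u‖ ^ 2 * (8 * (b * (B * θ))) ≤ n * ‖u‖ ^ 2 * c := by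
      gcongr
      by_contra! hlt'
      nlinarith
    linarith
  · rw [← mul_lt_mul_iff_right₀ (show 0 < 32 * b by positivity)]
    calc 32 * b * (4 * (m + B * θ)) = 128 * (b * (m + B * θ)) := by ring
      _ < c := hlt
      _ = 32 * b * (c / 4 * (b⁻¹ / 8)) := by field_simp; norm_num

theorem exists_mul_sq_norm_le_of_posDef {S : Matrix (Fin L) (Fin L) ℝ} (hS : S.PosDef) :
    ∃ c > 0, ∀ u : EuclideanSpace ℝ (Fin L), c * ‖u‖ ^ 2 ≤ ∑ j, ∑ k, S j k * (u j * u k) := by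
  set q : EuclideanSpace ℝ (Fin L) → ℝ := fun u => ∑ j, ∑ k, S j k * (u j * u k) with hq
  have hpos : ∀ u, u ≠ 0 → 0 < q u := by
    intro u hu
    have h := hS.dotProduct_mulVec_pos (x := u.ofLp) (by simpa using hu)
    simp only [dotProduct, Matrix.mulVec, Finset.mul_sum, star_trivial, Pi.star_apply] at h
    refine h.trans_eq ?_
    exact Finset.sum_congr rfl fun j _ => Finset.sum_congr rfl fun k _ => by ring
  have hcont : Continuous q := by fun_prop
  have hsmul : ∀ (t : ℝ) u, q (t • u) = t ^ 2 * q u := by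
    intro t u
    simp only [hq, Finset.mul_sum, PiLp.smul_apply, smul_eq_mul]
    exact Finset.sum_congr rfl fun j _ => Finset.sum_congr rfl fun k _ => by ring
  obtain ⟨c, hc, hle⟩ : ∃ c > 0, ∀ u ∈ Metric.sphere (0 : EuclideanSpace ℝ (Fin L)) 1, c ≤ q u := by
    rcases (Metric.sphere (0 : EuclideanSpace ℝ (Fin L)) 1).eq_empty_or_nonempty with he | hne
    · exact ⟨1, one_pos, by simp [he]⟩
    · obtain ⟨v, hv, hmin⟩ := (isCompact_sphere _ _).exists_isMinOn hne hcont.continuousOn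
      refine ⟨q v, hpos v ?_, fun u hu => hmin hu⟩
      rintro rfl
      simp at hv
  refine ⟨c, hc, fun u => ?_⟩
  rcases eq_or_ne u 0 with rfl | hu
  · simp
  · have hu' : 0 < ‖u‖ := norm_pos_iff.2 hu
    have h := hle (‖u‖⁻¹ • u) (by simp [norm_smul, hu'.ne'])
    rw [hsmul, inv_pow, inv_mul_eq_div, le_div_iff₀ (by positivity)] at h
    exact h

/-- The sample second moment matrix is bounded below in every direction at once, with probability
tending to one. -/
theorem eventually_whp_secondMoment [IsProbabilityMeasure μ] (hD : ∀ i, HasLaw (D i) P μ)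
    (hind : iIndepFun D μ) {φ : 𝒟 → EuclideanSpace ℝ (Fin L)}
    (hφ : ∀ j k, Integrable (fun d => φ d j * φ d k) P)
    (hS : (Matrix.of fun j k => ∫ d, φ d j * φ d k ∂P).PosDef) :
    ∃ c > 0, ∀ᶠ z in whp μ, ∀ u, z.1 * (c * ‖u‖ ^ 2) ≤ ∑ i : Fin z.1, ⟪u, φ (D i z.2)⟫ ^ 2 := by
  obtain ⟨c, hc, hle⟩ := exists_mul_sq_norm_le_of_posDef hS
  set η : ℝ := c / (2 * (L ^ 2 + 1)) with hη
  have hη0 : 0 < η := by positivity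
  have hηL : η * L ^ 2 ≤ c / 2 := by
    rw [hη, div_mul_eq_mul_div, div_le_div_iff₀ (by positivity) (by positivity)]
    nlinarith
  refine ⟨c / 2, by positivity, ?_⟩
  have hall : ∀ᶠ z in whp μ, ∀ j k, ‖(z.1 : ℝ)⁻¹ • ∑ i : Fin z.1, φ (D i z.2) j * φ (D i z.2) k -
      ∫ d, φ d j * φ d k ∂P‖ < η :=
    eventually_all.2 fun j => eventually_all.2 fun k =>
      eventually_whp_norm_average_sub_lt hD hind (hφ j k) hη0
  filter_upwards [hall, eventually_whp_of_atTop (eventually_gt_atTop 0)] with z hz hn u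
  have hn' : (0 : ℝ) < z.1 := by exact_mod_cast hn
  have habs : ∀ j, |u j| ≤ ‖u‖ := fun j => by simpa using PiLp.norm_apply_le u j
  have e : ∑ i : Fin z.1, ⟪u, φ (D i z.2)⟫ ^ 2 =
      z.1 * ∑ j, ∑ k, ((z.1 : ℝ)⁻¹ • ∑ i : Fin z.1, φ (D i z.2) j * φ (D i z.2) k) *
        (u j * u k) := by
    simp only [smul_eq_mul, mul_assoc, ← Finset.mul_sum]
    rw [mul_inv_cancel_left₀ hn'.ne']
    simp only [Finset.sum_mul]
    rw [Finset.sum_congr rfl fun j _ => Finset.sum_comm, Finset.sum_comm]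
    refine Finset.sum_congr rfl fun i _ => ?_
    simp only [PiLp.inner_apply, RCLike.inner_apply, conj_trivial, sq, Finset.sum_mul_sum]
    exact Finset.sum_congr rfl fun j _ => Finset.sum_congr rfl fun k _ => by ring
  rw [e]
  gcongr
  have hterm : ∀ j k, (∫ d, φ d j * φ d k ∂P) * (u j * u k) - η * ‖u‖ ^ 2 ≤
      ((z.1 : ℝ)⁻¹ • ∑ i : Fin z.1, φ (D i z.2) j * φ (D i z.2) k) * (u j * u k) := by
    intro j k
    have h1 := (hz j k).le
    rw [Real.norm_eq_abs] at h1
    have h2 : |u j * u k| ≤ ‖u‖ ^ 2 := by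
      rw [abs_mul, sq]; exact mul_le_mul (habs j) (habs k) (abs_nonneg _) (norm_nonneg _)
    have h3 := mul_le_mul h1 h2 (abs_nonneg _) hη0.le
    rw [← abs_mul] at h3
    have h4 := neg_le_of_abs_le h3
    rw [sub_mul] at h4
    linarith
  have hsum := Finset.sum_le_sum fun j (_ : j ∈ Finset.univ) =>
    Finset.sum_le_sum fun k (_ : k ∈ Finset.univ) => hterm j k
  simp only [Finset.sum_sub_distrib, Finset.sum_const, Finset.card_univ, Fintype.card_fin,
    nsmul_eq_mul] at hsum
  have h5 := hle u
  simp only [Matrix.of_apply] at h5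
  have h6 : η * L ^ 2 * ‖u‖ ^ 2 ≤ c / 2 * ‖u‖ ^ 2 := by gcongr
  nlinarith

theorem norm_le_sum_abs (v : EuclideanSpace ℝ (Fin L)) : ‖v‖ ≤ ∑ j, |v j| := by
  conv_lhs => rw [← (EuclideanSpace.basisFun (Fin L) ℝ).sum_repr v]
  refine (norm_sum_le _ _).trans (le_of_eq (Finset.sum_congr rfl fun j _ => ?_))
  simp [norm_smul]

theorem eventually_whp_norm_sum_le [IsProbabilityMeasure μ] (hD : ∀ i, HasLaw (D i) P μ)
    (hind : iIndepFun D μ) {φ : 𝒟 → EuclideanSpace ℝ (Fin L)} (hφ : ∀ j, MemLp (fun d => φ d j) 2 P)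
    (h0 : ∀ j, ∫ d, φ d j ∂P = 0) {a : ℕ → ℝ} (ha : Tendsto a atTop atTop) :
    ∀ᶠ z in whp μ, ‖∑ i : Fin z.1, φ (D i z.2)‖ ≤ L * (a z.1 * √z.1) := by
  have hall : ∀ᶠ z in whp μ, ∀ j, |∑ i : Fin z.1, φ (D i z.2) j| ≤ a z.1 * √z.1 :=
    eventually_all.2 fun j => eventually_whp_abs_sum_le hD hind (hφ j) (h0 j) ha
  filter_upwards [hall] with z hz
  refine (norm_le_sum_abs _).trans ?_
  refine (Finset.sum_le_card_nsmul _ _ (a z.1 * √z.1) fun j _ => ?_).trans_eq (by simp)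
  simpa using hz j

/-- In the true model a multiplier exists with probability tending to one, and the log likelihood
ratio is at most of the order of `a n ^ 2` for every slowly growing sequence `a`; thus it is
`O_p(1)`. -/
theorem Regular.exists_eventually_whp_isMultiplier [IsProbabilityMeasure μ]
    [IsProbabilityMeasure P] (hD : ∀ i, HasLaw (D i) P μ) (hind : iIndepFun D μ)
    {g : 𝒟 → EuclideanSpace ℝ (Fin p) → EuclideanSpace ℝ (Fin L)}
    (hg : Measurable (Function.uncurry g)) {γ₀ : EuclideanSpace ℝ (Fin p)} (hreg : Regular P g γ₀)
    {γhat : ℕ → Ω → EuclideanSpace ℝ (Fin p)}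
    (hroot : BoundedInProbability μ fun n ω => √(n : ℝ) * ‖γhat n ω - γ₀‖)
    {a : ℕ → ℝ} (ha : Tendsto a atTop atTop)
    (ha' : Tendsto (fun n : ℕ => (n : ℝ) ^ (1 / 3 : ℝ) * (a n / √n)) atTop (𝓝 0)) :
    ∃ K, ∀ᶠ z in whp μ, ∃ lam,
      IsMultiplier (fun i : Fin z.1 => g (D i z.2) (γhat z.1 z.2)) lam ∧
        ∑ i : Fin z.1, Real.log (1 + ⟪lam, g (D i z.2) (γhat z.1 z.2)⟫) ≤ K * a z.1 ^ 2 := by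
  obtain ⟨U, hU, hγU, hsmooth, G, hG, hdom⟩ := hreg.smooth_dominated
  obtain ⟨r, hr, hball⟩ := Metric.isOpen_iff.1 hU γ₀ hγU
  have hgm : Measurable fun d => g d γ₀ := hg.comp (measurable_id.prodMk measurable_const)
  have h2 : MemLp (fun d => g d γ₀) 2 P := by
    have h3 : MemLp (fun d => g d γ₀) 3 P := by
      refine (integrable_norm_rpow_iff hgm.aestronglyMeasurable (by simp) (by simp)).1 ?_
      refine hG.mono' ?_ ?_
      · exact (hgm.norm.pow_const _).aestronglyMeasurable
      · filter_upwards [hdom] with d hd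
        have := (hd γ₀ hγU).2.2
        rw [Real.norm_of_nonneg (by positivity)]
        simpa using this
    exact h3.mono_exponent (by norm_num)
  have h2j : ∀ j, MemLp (fun d => g d γ₀ j) 2 P := fun j =>
    h2.mono (by fun_prop) (Eventually.of_forall fun d => by simpa using PiLp.norm_apply_le (g d γ₀) j)
  have h0j : ∀ j, ∫ d, g d γ₀ j ∂P = 0 := by
    intro j
    have := (EuclideanSpace.proj (𝕜 := ℝ) j).integral_comp_comm (h2.integrable one_le_two)
    simpa [hreg.mean_zero] using this
  obtain ⟨c, hc, hsecond⟩ := eventually_whp_secondMoment hD hind (φ := fun d => g d γ₀)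
    (fun j k => (h2j j).integrable_mul (h2j k)) hreg.posDef
  have hpt : ∀ᵐ d ∂P, ∀ γ ∈ Metric.ball γ₀ r,
      ‖g d γ - g d γ₀‖ ≤ G d * ‖γ - γ₀‖ ∧ ‖g d γ‖ ^ 3 ≤ G d := by
    filter_upwards [hsmooth, hdom] with d hs hd γ hγ
    refine ⟨?_, (hd γ (hball hγ)).2.2⟩
    refine (convex_ball γ₀ r).norm_image_sub_le_of_norm_fderiv_le (𝕜 := ℝ) (fun v hv => ?_)
      (fun v hv => (hd v (hball hv)).1) (Metric.mem_ball_self hr) hγ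
    exact ((hs v (hball hv)).contDiffAt (hU.mem_nhds (hball hv))).differentiableAt (by norm_num)
  set B : ℝ := |∫ d, G d ∂P| + 1 with hB
  have hB0 : 0 < B := by positivity
  refine ⟨(L + B) ^ 2 / (c / 4), ?_⟩
  have hev : ∀ᶠ n : ℕ in atTop, 0 < n ∧ 0 ≤ a n ∧
      (n : ℝ) ^ (1 / 3 : ℝ) * (a n / √n) < min r (c / (128 * (L + B))) :=
    (eventually_gt_atTop 0).and ((ha.eventually_ge_atTop 0).and
      (ha'.eventually_lt_const (lt_min hr (by positivity))))
  filter_upwards [hroot.eventually_whp ha, eventually_whp_forall_of_ae hD hpt,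
    eventually_whp_norm_average_sub_lt hD hind hG one_pos, eventually_whp_forall_le hD hG,
    eventually_whp_norm_sum_le hD hind h2j h0j ha, hsecond, eventually_whp_of_atTop hev]
    with z e1 e2 e3 e4 e5 e6 e7
  obtain ⟨n, ω⟩ := z
  obtain ⟨hn, ha0, hlt⟩ := e7
  simp only at *
  have hn' : (0 : ℝ) < n := by exact_mod_cast hn
  have hn1 : (1 : ℝ) ≤ n := by exact_mod_cast hn
  have hsq : 0 < √(n : ℝ) := Real.sqrt_pos.2 hn'
  set b : ℝ := (n : ℝ) ^ (1 / 3 : ℝ) with hb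
  have hb1 : 1 ≤ b := Real.one_le_rpow hn1 (by norm_num)
  have hb3 : b ^ 3 = n := by
    rw [hb, ← Real.rpow_natCast, ← Real.rpow_mul hn'.le]; norm_num
  set s : ℝ := a n / √n with hs
  have hs0 : 0 ≤ s := by positivity
  have hbs : s ≤ b * s := by nlinarith
  have hθ : ‖γhat n ω - γ₀‖ ≤ s := by
    rw [hs, le_div_iff₀ hsq, mul_comm]
    exact (le_abs_self _).trans e1
  have hmem : γhat n ω ∈ Metric.ball γ₀ r := by
    rw [mem_ball_iff_norm]
    exact (hθ.trans hbs).trans_lt (hlt.trans_le (min_le_left _ _))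
  have hcube : ∀ i : Fin n, ∀ γ ∈ Metric.ball γ₀ r, ‖g (D i ω) γ‖ ≤ b := by
    intro i γ hγ
    refine le_of_pow_le_pow_left₀ three_ne_zero (by positivity) ?_
    rw [hb3]
    exact ((e2 i γ hγ).2).trans (e4 i)
  have hGsum : ∑ i : Fin n, G (D i ω) ≤ n * B := by
    have h1 := (le_abs_self _).trans e3.le
    have h2 : (n : ℝ)⁻¹ * ∑ i : Fin n, G (D i ω) ≤ B := by
      have := le_abs_self (∫ d, G d ∂P)
      rw [smul_eq_mul] at h1
      linarith
    rwa [inv_mul_le_iff₀ hn'] at h2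
  have hG0 : ∀ i : Fin n, 0 ≤ G (D i ω) := fun i =>
    (by positivity : (0 : ℝ) ≤ ‖g (D i ω) γ₀‖ ^ 3).trans (e2 i γ₀ (Metric.mem_ball_self hr)).2
  obtain ⟨lam, hlam, hle⟩ := exists_isMultiplier_of_close hn
    (x := fun i : Fin n => g (D i ω) (γhat n ω)) (y := fun i : Fin n => g (D i ω) γ₀)
    (w := fun i => G (D i ω)) (b := b) (c := c) (m := L * s) (B := B) (θ := s)
    (by positivity) hc hs0 (fun i => hcube i _ hmem)
    (fun i => hcube i _ (Metric.mem_ball_self hr))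
    (fun i => ((e2 i _ hmem).1).trans (mul_le_mul_of_nonneg_left hθ (hG0 i))) hGsum
    (e5.trans (le_of_eq (by rw [hs]; field_simp; rw [Real.sq_sqrt hn'.le, mul_comm])))
    e6 (by
      have h1 := hlt.trans_le (min_le_right _ _)
      rw [lt_div_iff₀ (by positivity)] at h1
      linarith)
  refine ⟨lam, hlam, hle.trans (le_of_eq ?_)⟩
  rw [hs]
  field_simp
  rw [Real.sq_sqrt hn'.le, mul_comm]

end TrueModel

/-! ### The criterion of a misspecified model -/

section Misspecified

variable {𝒟 : Type*} {p L : ℕ}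

/-- The oscillation of `g d` about `γs` on the ball of radius `r`, as a supremum over a countable
dense set of parameters so that it is measurable in `d`. -/
noncomputable def oscillation (g : 𝒟 → EuclideanSpace ℝ (Fin p) → EuclideanSpace ℝ (Fin L))
    (γs : EuclideanSpace ℝ (Fin p)) (r : ℝ) (d : 𝒟) : ℝ≥0∞ :=
  ⨆ q ∈ Set.range (TopologicalSpace.denseSeq (EuclideanSpace ℝ (Fin p))) ∩ Metric.ball γs r,
    ‖g d q - g d γs‖ₑ

variable {g : 𝒟 → EuclideanSpace ℝ (Fin p) → EuclideanSpace ℝ (Fin L)}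
  {γs : EuclideanSpace ℝ (Fin p)} {U : Set (EuclideanSpace ℝ (Fin p))}

theorem enorm_sub_le_oscillation {r : ℝ} (hr : Metric.ball γs r ⊆ U) {d : 𝒟}
    (hd : ContinuousOn (g d) U) {γ : EuclideanSpace ℝ (Fin p)} (hγ : γ ∈ Metric.ball γs r) :
    ‖g d γ - g d γs‖ₑ ≤ oscillation g γs r d := by
  have hcl : γ ∈ closure
      (Metric.ball γs r ∩ Set.range (TopologicalSpace.denseSeq (EuclideanSpace ℝ (Fin p)))) :=
    (TopologicalSpace.denseRange_denseSeq _).open_subset_closure_inter Metric.isOpen_ball hγ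
  have hcont : ContinuousWithinAt (fun q => ‖g d q - g d γs‖ₑ)
      (Metric.ball γs r ∩ Set.range (TopologicalSpace.denseSeq (EuclideanSpace ℝ (Fin p)))) γ :=
    (((hd.mono hr) γ hγ).mono Set.inter_subset_left |>.sub continuousWithinAt_const).enorm
  have hne : (𝓝[Metric.ball γs r ∩ Set.range
      (TopologicalSpace.denseSeq (EuclideanSpace ℝ (Fin p)))] γ).NeBot :=
    mem_closure_iff_nhdsWithin_neBot.1 hcl
  refine le_of_tendsto hcont.tendsto ?_
  filter_upwards [self_mem_nhdsWithin] with q hq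
  exact le_iSup₂ (f := fun q (_ : q ∈ Set.range (TopologicalSpace.denseSeq
    (EuclideanSpace ℝ (Fin p))) ∩ Metric.ball γs r) => ‖g d q - g d γs‖ₑ) q ⟨hq.2, hq.1⟩

variable {Ω : Type*} [MeasurableSpace 𝒟] [MeasurableSpace Ω] {μ : Measure Ω} {P : Measure 𝒟}
  {D : ℕ → Ω → 𝒟}

theorem measurable_apply (hg : Measurable (Function.uncurry g)) (γ : EuclideanSpace ℝ (Fin p)) :
    Measurable fun d => g d γ :=
  hg.comp (measurable_id.prodMk measurable_const)

theorem measurable_oscillation (hg : Measurable (Function.uncurry g)) (r : ℝ) :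
    Measurable (oscillation g γs r) :=
  Measurable.biSup _ ((Set.countable_range _).mono Set.inter_subset_left) fun q _ =>
    ((measurable_apply hg q).sub (measurable_apply hg γs)).enorm

theorem tendsto_lintegral_oscillation (hg : Measurable (Function.uncurry g)) (hU : IsOpen U)
    (hγs : γs ∈ U) (hcont : ∀ᵐ d ∂P, ContinuousOn (g d) U) {H : 𝒟 → ℝ} (hH : Integrable H P)
    (hdom : ∀ᵐ d ∂P, ∀ γ ∈ U, ‖g d γ‖ ≤ H d) :
    Tendsto (fun r => ∫⁻ d, oscillation g γs r d ∂P) (𝓝[>] 0) (𝓝 0) := by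
  obtain ⟨r₀, hr₀, hball⟩ := Metric.isOpen_iff.1 hU γs hγs
  have h0 : (0 : ℝ≥0∞) = ∫⁻ _, 0 ∂P := by simp
  rw [h0]
  refine tendsto_lintegral_filter_of_dominated_convergence (fun d => ENNReal.ofReal (2 * H d))
    (Eventually.of_forall fun r => measurable_oscillation hg r) ?_
    ((lintegral_ofReal_le_lintegral_enorm _).trans_lt (hH.const_mul 2).hasFiniteIntegral).ne ?_
  · filter_upwards [Ioo_mem_nhdsGT hr₀] with r hr
    filter_upwards [hdom] with d hd
    refine iSup₂_le fun q hq => ?_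
    rw [← ofReal_norm]
    refine ENNReal.ofReal_le_ofReal ((norm_sub_le _ _).trans ?_)
    have h1 := hd q (hball (Metric.ball_subset_ball hr.2.le hq.2))
    have h2 := hd γs hγs
    linarith
  · filter_upwards [hcont] with d hd
    rw [ENNReal.tendsto_nhds_zero]
    intro ε hε
    have hc : ContinuousAt (fun q => ‖g d q - g d γs‖ₑ) γs :=
      ((hd.continuousAt (hU.mem_nhds hγs)).sub continuousAt_const).enorm
    have hev : ∀ᶠ q in 𝓝 γs, ‖g d q - g d γs‖ₑ ≤ ε := by
      have : Tendsto (fun q => ‖g d q - g d γs‖ₑ) (𝓝 γs) (𝓝 0) := by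
        simpa [ContinuousAt] using hc
      exact (ENNReal.tendsto_nhds_zero.1 this) ε hε
    obtain ⟨s, hs, hsub⟩ := Metric.eventually_nhds_iff_ball.1 hev
    filter_upwards [Ioo_mem_nhdsGT hs] with r hr
    exact iSup₂_le fun q hq => hsub q (Metric.ball_subset_ball hr.2.le hq.2)

/-- A law of large numbers at an estimated parameter: if `γhat` converges in probability to `γs`,
the average of `g (D i, γhat)` converges in probability to the mean of `g (D, γs)`. The error
committed by replacing `γhat` by `γs` is at most the average oscillation of `g` near `γs`, which
has small expectation. -/
theorem eventually_whp_norm_average_plugin_sub_lt [IsProbabilityMeasure μ]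
    (hD : ∀ i, HasLaw (D i) P μ) (hind : iIndepFun D μ) (hg : Measurable (Function.uncurry g))
    (hU : IsOpen U) (hγs : γs ∈ U) (hcont : ∀ᵐ d ∂P, ContinuousOn (g d) U) {H : 𝒟 → ℝ}
    (hH : Integrable H P) (hdom : ∀ᵐ d ∂P, ∀ γ ∈ U, ‖g d γ‖ ≤ H d)
    {γhat : ℕ → Ω → EuclideanSpace ℝ (Fin p)}
    (hγ : TendstoInMeasure μ γhat atTop fun _ => γs) {ε : ℝ} (hε : 0 < ε) :
    ∀ᶠ z in whp μ, ‖(z.1 : ℝ)⁻¹ • ∑ i : Fin z.1, g (D i z.2) (γhat z.1 z.2) -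
      ∫ d, g d γs ∂P‖ < ε := by
  have hint : Integrable (fun d => g d γs) P :=
    hH.mono' (measurable_apply hg γs).aestronglyMeasurable (hdom.mono fun d hd => hd γs hγs)
  refine eventually_whp_of_le (p := fun n ω => ‖(n : ℝ)⁻¹ • ∑ i : Fin n, g (D i ω) (γhat n ω) -
      ∫ d, g d γs ∂P‖ < ε) fun η hη => ?_
  have hη2 : 0 < η / 2 := ENNReal.half_pos hη.ne'
  have hε2 : 0 < ENNReal.ofReal (ε / 2) := by simpa using hε
  obtain ⟨r₀, hr₀, hball⟩ := Metric.isOpen_iff.1 hU γs hγs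
  -- the radius is chosen so that Markov's inequality gives failure probability at most `η / 2`
  obtain ⟨r, hosc, hr, hrr₀⟩ : ∃ r, ∫⁻ d, oscillation g γs r d ∂P ≤
      ENNReal.ofReal (ε / 2) * (η / 2) ∧ r ∈ Set.Ioo 0 r₀ ∧ r < r₀ := by
    have h1 := (ENNReal.tendsto_nhds_zero.1
      (tendsto_lintegral_oscillation hg hU hγs hcont hH hdom)) _ (ENNReal.mul_pos hε2.ne' hη2.ne')
    obtain ⟨r, h1, h2⟩ := (h1.and (Ioo_mem_nhdsGT hr₀)).exists
    exact ⟨r, h1, h2, h2.2⟩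
  have hmarkov : ∀ᶠ n : ℕ in atTop,
      μ {ω | n * ENNReal.ofReal (ε / 2) ≤ ∑ i : Fin n, oscillation g γs r (D i ω)} ≤ η / 2 := by
    filter_upwards [eventually_gt_atTop 0] with n hn
    have hm : ∀ i, AEMeasurable (fun ω => oscillation g γs r (D i ω)) μ := fun i =>
      (measurable_oscillation hg r).comp_aemeasurable (hD i).aemeasurable
    have h := mul_meas_ge_le_lintegral₀ (μ := μ)
      (Finset.aemeasurable_fun_sum Finset.univ fun (i : Fin n) _ => hm i)
      (n * ENNReal.ofReal (ε / 2))
    rw [lintegral_finsetSum' _ fun (i : Fin n) _ => hm i, Finset.sum_congr rfl fun (i : Fin n) _ =>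
      (hD i).lintegral_comp (measurable_oscillation hg r).aemeasurable] at h
    simp only [Finset.sum_const, Finset.card_univ, Fintype.card_fin, nsmul_eq_mul] at h
    rw [mul_assoc, ENNReal.mul_le_mul_iff_right (by simpa using hn.ne') (by simp)] at h
    exact (ENNReal.mul_le_mul_iff_right hε2.ne' ENNReal.ofReal_ne_top).1 (h.trans hosc)
  have hgood := (eventually_whp_of_tendstoInMeasure hγ hr.1).and
    ((eventually_whp_forall_of_ae hD hcont).and
      ((eventually_whp_norm_average_sub_lt hD hind hint (half_pos hε)).and
        (eventually_whp_of_atTop (μ := μ) (eventually_gt_atTop 0))))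
  filter_upwards [hmarkov, ENNReal.tendsto_nhds_zero.1 (eventually_whp.1 hgood) _ hη2] with n h1 h2
  refine (measure_mono ?_).trans ((measure_union_le _ _).trans
    ((add_le_add h1 h2).trans_eq (ENNReal.add_halves η)))
  intro ω hω
  by_contra hc
  simp only [Set.mem_union, Set.mem_ofPred_eq, not_or, not_not, not_le] at hc
  obtain ⟨hsum, hdist, hco, hlln, hn⟩ := hc
  refine hω ?_
  have hn' : (0 : ℝ) < n := by exact_mod_cast hn
  have hdiff : ‖∑ i : Fin n, (g (D i ω) (γhat n ω) - g (D i ω) γs)‖ < n * (ε / 2) := by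
    have h3 : ‖∑ i : Fin n, (g (D i ω) (γhat n ω) - g (D i ω) γs)‖ₑ <
        n * ENNReal.ofReal (ε / 2) := by
      refine ((enorm_sum_le _ _).trans (Finset.sum_le_sum fun i _ => ?_)).trans_lt hsum
      exact enorm_sub_le_oscillation ((Metric.ball_subset_ball hrr₀.le).trans hball) (hco i) hdist
    rw [← ofReal_norm, ← ENNReal.ofReal_natCast, ← ENNReal.ofReal_mul hn'.le] at h3
    exact (ENNReal.ofReal_lt_ofReal_iff (by positivity)).1 h3
  have hsplit : (n : ℝ)⁻¹ • ∑ i : Fin n, g (D i ω) (γhat n ω) - ∫ d, g d γs ∂P =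
      (n : ℝ)⁻¹ • ∑ i : Fin n, (g (D i ω) (γhat n ω) - g (D i ω) γs) +
        ((n : ℝ)⁻¹ • ∑ i : Fin n, g (D i ω) γs - ∫ d, g d γs ∂P) := by
    rw [Finset.sum_sub_distrib, smul_sub]; abel
  rw [hsplit]
  refine (norm_add_le _ _).trans_lt ?_
  have h4 : ‖(n : ℝ)⁻¹ • ∑ i : Fin n, (g (D i ω) (γhat n ω) - g (D i ω) γs)‖ < ε / 2 := by
    rw [norm_smul, norm_inv, Real.norm_natCast, inv_mul_lt_iff₀ hn']
    exact hdiff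
  linarith

/-- The dual objective in the direction `v` when the sample mean is close to `v`: the linear term
of order `n / b` dominates the quadratic one of order `n / b ^ 2`. -/
theorem exists_le_sum_log {n : ℕ} {x : Fin n → EuclideanSpace ℝ (Fin L)}
    {v : EuclideanSpace ℝ (Fin L)} {b B : ℝ} (hn : 0 < n) (hb : 0 < b) (hv : v ≠ 0)
    (hx : ∀ i, ‖x i‖ ≤ b) (hmean : ‖(n : ℝ)⁻¹ • ∑ i, x i - v‖ ≤ ‖v‖ / 2)
    (hB : ∑ i, ‖x i‖ ^ 2 ≤ n * B) (hbB : B ≤ 2 * ‖v‖ * b) :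
    ∃ ν, (∀ i, 0 < 1 + ⟪ν, x i⟫) ∧
      ‖v‖ / 32 * (n / b) ≤ ∑ i, Real.log (1 + ⟪ν, x i⟫) := by
  have hn' : (0 : ℝ) < n := by exact_mod_cast hn
  have hv' : 0 < ‖v‖ := norm_pos_iff.2 hv
  set t : ℝ := (8 * (b * ‖v‖))⁻¹ with ht
  have ht0 : 0 < t := by positivity
  have htv : t * ‖v‖ = 1 / (8 * b) := by rw [ht]; field_simp
  have habs : ∀ i, |⟪t • v, x i⟫| ≤ t * ‖v‖ * ‖x i‖ := fun i => by
    refine (abs_real_inner_le_norm _ _).trans (le_of_eq ?_)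
    rw [norm_smul, Real.norm_of_nonneg ht0.le]
  have h8 : ∀ i, |⟪t • v, x i⟫| ≤ 1 / 8 := fun i => by
    refine (habs i).trans ?_
    rw [htv]
    calc 1 / (8 * b) * ‖x i‖ ≤ 1 / (8 * b) * b := by gcongr; exact hx i
      _ = 1 / 8 := by field_simp
  refine ⟨t • v, fun i => by linarith [neg_le_of_abs_le (h8 i)], ?_⟩
  have hlin : n * (‖v‖ ^ 2 / 2) ≤ ⟪v, ∑ i, x i⟫ := by
    have h1 : ⟪v, (n : ℝ)⁻¹ • ∑ i, x i⟫ = ‖v‖ ^ 2 + ⟪v, (n : ℝ)⁻¹ • ∑ i, x i - v⟫ := by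
      rw [inner_sub_right, real_inner_self_eq_norm_sq]; ring
    have h2 := neg_le_of_abs_le (abs_real_inner_le_norm v ((n : ℝ)⁻¹ • ∑ i, x i - v))
    have h3 : ‖v‖ * ‖(n : ℝ)⁻¹ • ∑ i, x i - v‖ ≤ ‖v‖ * (‖v‖ / 2) := by gcongr
    rw [inner_smul_right] at h1
    have h4 : ‖v‖ ^ 2 / 2 ≤ (n : ℝ)⁻¹ * ⟪v, ∑ i, x i⟫ := by nlinarith
    rwa [le_inv_mul_iff₀ hn'] at h4
  have hsq : ∑ i, ⟪t • v, x i⟫ ^ 2 ≤ (t * ‖v‖) ^ 2 * (n * B) := by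
    calc ∑ i, ⟪t • v, x i⟫ ^ 2 ≤ ∑ i, (t * ‖v‖) ^ 2 * ‖x i‖ ^ 2 := by
          refine Finset.sum_le_sum fun i _ => ?_
          rw [← mul_pow, ← sq_abs]
          gcongr
          exact habs i
      _ ≤ _ := by rw [← Finset.mul_sum]; gcongr
  have hlog := Finset.sum_le_sum fun i (_ : i ∈ Finset.univ) => sub_sq_le_log_one_add (h8 i)
  rw [Finset.sum_sub_distrib, ← inner_sum, inner_smul_left, conj_trivial] at hlog
  have h5 := mul_le_mul_of_nonneg_left hlin ht0.le
  have h6 : t * (n * (‖v‖ ^ 2 / 2)) = ‖v‖ / 16 * (n / b) := by rw [ht]; field_simp; norm_num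
  have h7 : (t * ‖v‖) ^ 2 * (n * B) ≤ ‖v‖ / 32 * (n / b) := by
    calc (t * ‖v‖) ^ 2 * (n * B) ≤ (t * ‖v‖) ^ 2 * (n * (2 * ‖v‖ * b)) := by gcongr
      _ = ‖v‖ / 32 * (n / b) := by rw [htv]; field_simp; norm_num
  linarith

/-- In a misspecified model the log likelihood ratio exceeds every multiple of `log n`: it is at
least of the order of `n / b` for every bound `b` of the `‖x i‖`, and `b = n ^ (1 / (2 + δ))` is one
with probability tending to one. -/
theorem MisspecifiedRegular.eventually_whp_mul_log_lt [IsProbabilityMeasure μ]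
    [IsProbabilityMeasure P] (hD : ∀ i, HasLaw (D i) P μ) (hind : iIndepFun D μ)
    (hg : Measurable (Function.uncurry g)) (hmis : MisspecifiedRegular P g γs)
    (hid : Identifiable P g γs) {γhat : ℕ → Ω → EuclideanSpace ℝ (Fin p)}
    (hγ : TendstoInMeasure μ γhat atTop fun _ => γs) (C : ℝ) :
    ∀ᶠ z in whp μ, ∃ ν, (∀ i : Fin z.1, 0 < 1 + ⟪ν, g (D i z.2) (γhat z.1 z.2)⟫) ∧
      C * Real.log z.1 < ∑ i : Fin z.1, Real.log (1 + ⟪ν, g (D i z.2) (γhat z.1 z.2)⟫) := by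
  obtain ⟨U, hU, hγs, hcont, δ, hδ, G, hG, hdom⟩ := hmis
  have hv' : 0 < ‖∫ d, g d γs ∂P‖ := hid.self_of_nhds
  set v := ∫ d, g d γs ∂P with hv
  have hpow : ∀ (e : ℝ) (y : ℝ), 0 ≤ y → 0 ≤ e → e ≤ 2 + δ → y ^ e ≤ 1 + y ^ (2 + δ) := by
    intro e y hy he hle
    rcases le_total y 1 with h | h
    · have := Real.rpow_le_one hy h he
      have := Real.rpow_nonneg hy (2 + δ)
      linarith
    · have := Real.rpow_le_rpow_of_exponent_le h hle
      linarith
  have hG1 : Integrable (fun d => 1 + G d) P := (integrable_const 1).add hG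
  have hdom1 : ∀ᵐ d ∂P, ∀ γ ∈ U, ‖g d γ‖ ≤ 1 + G d := by
    filter_upwards [hdom] with d hd γ hγU
    have h := hpow 1 ‖g d γ‖ (norm_nonneg _) zero_le_one (by linarith)
    rw [Real.rpow_one] at h
    linarith [hd γ hγU]
  obtain ⟨r, hr, hball⟩ := Metric.isOpen_iff.1 hU γs hγs
  set B : ℝ := |∫ d, (1 + G d) ∂P| + 1 with hB
  have hexp : 0 < 1 - (2 + δ)⁻¹ := by
    have : (2 + δ)⁻¹ < 1 := inv_lt_one_of_one_lt₀ (by linarith)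
    linarith
  have hlog : ∀ᶠ n : ℕ in atTop, C * Real.log n < ‖v‖ / 32 * (n : ℝ) ^ (1 - (2 + δ)⁻¹) := by
    have h1 := (isLittleO_log_rpow_atTop hexp).comp_tendsto tendsto_natCast_atTop_atTop
    have h2 := h1.def (show 0 < ‖v‖ / 64 / (|C| + 1) by positivity)
    filter_upwards [h2, eventually_gt_atTop 0] with n h3 hn
    have hn' : (0 : ℝ) < n := by exact_mod_cast hn
    have hp : 0 < (n : ℝ) ^ (1 - (2 + δ)⁻¹) := Real.rpow_pos_of_pos hn' _
    simp only [Function.comp_apply, Real.norm_eq_abs, abs_of_pos hp] at h3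
    rw [div_mul_eq_mul_div, le_div_iff₀ (by positivity)] at h3
    have h4 : C * Real.log n ≤ |C| * |Real.log n| := by rw [← abs_mul]; exact le_abs_self _
    have h5 := abs_nonneg (Real.log n)
    have h6 : 0 < ‖v‖ * (n : ℝ) ^ (1 - (2 + δ)⁻¹) := by positivity
    linarith
  have hbig : ∀ᶠ n : ℕ in atTop, B ≤ 2 * ‖v‖ * (n : ℝ) ^ (2 + δ)⁻¹ :=
    (((tendsto_rpow_atTop (show 0 < (2 + δ)⁻¹ by positivity)).comp
      tendsto_natCast_atTop_atTop).const_mul_atTop (by positivity)).eventually_ge_atTop B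
  filter_upwards [eventually_whp_of_tendstoInMeasure hγ hr, eventually_whp_forall_of_ae hD hdom,
    eventually_whp_forall_le hD hG, eventually_whp_norm_average_sub_lt hD hind hG1 one_pos,
    eventually_whp_norm_average_plugin_sub_lt hD hind hg hU hγs hcont hG1 hdom1 hγ (half_pos hv'),
    eventually_whp_of_atTop ((eventually_gt_atTop 0).and (hlog.and hbig))]
    with z e1 e2 e3 e4 e5 e6
  obtain ⟨n, ω⟩ := z
  obtain ⟨hn, h1, h2⟩ := e6
  simp only at *
  have hn' : (0 : ℝ) < n := by exact_mod_cast hn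
  have hmem := hball (Metric.mem_ball.2 e1)
  set b : ℝ := (n : ℝ) ^ (2 + δ)⁻¹ with hb
  have hb0 : 0 < b := Real.rpow_pos_of_pos hn' _
  have hnb : (n : ℝ) / b = (n : ℝ) ^ (1 - (2 + δ)⁻¹) := by
    rw [Real.rpow_sub hn', Real.rpow_one]
  have hsq : ∑ i : Fin n, ‖g (D i ω) (γhat n ω)‖ ^ 2 ≤ n * B := by
    have h3 : ∑ i : Fin n, ‖g (D i ω) (γhat n ω)‖ ^ 2 ≤ ∑ i : Fin n, (1 + G (D i ω)) := by
      refine Finset.sum_le_sum fun i _ => ?_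
      have h := hpow 2 ‖g (D i ω) (γhat n ω)‖ (norm_nonneg _) zero_le_two (by linarith)
      rw [Real.rpow_two] at h
      linarith [e2 i _ hmem]
    refine h3.trans ?_
    have h4 := (le_abs_self _).trans e4.le
    have h5 : (n : ℝ)⁻¹ * ∑ i : Fin n, (1 + G (D i ω)) ≤ B := by
      have := le_abs_self (∫ d, (1 + G d) ∂P)
      rw [smul_eq_mul] at h4
      linarith
    rwa [inv_mul_le_iff₀ hn'] at h5
  obtain ⟨ν, hν, hle⟩ := exists_le_sum_log (x := fun i : Fin n => g (D i ω) (γhat n ω)) (B := B)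
    hn hb0 (norm_pos_iff.1 hv')
    (fun i => by
      rw [hb, Real.le_rpow_inv_iff_of_pos (norm_nonneg _) hn'.le (by positivity)]
      exact (e2 i _ hmem).trans (e3 i))
    e5.le hsq h2
  exact ⟨ν, hν, h1.trans_le (by rwa [hnb] at hle)⟩

end Misspecified

/-! ### Comparison of the criteria -/

theorem tendsto_sqrt_sqrt_log : Tendsto (fun n : ℕ => √√(Real.log n)) atTop atTop :=
  Real.tendsto_sqrt_atTop.comp (Real.tendsto_sqrt_atTop.comp
    (Real.tendsto_log_atTop.comp tendsto_natCast_atTop_atTop))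

theorem tendsto_rpow_mul_sqrt_sqrt_log_div_sqrt :
    Tendsto (fun n : ℕ => (n : ℝ) ^ (1 / 3 : ℝ) * (√√(Real.log n) / √n)) atTop (𝓝 0) := by
  have h := ((isLittleO_log_rpow_atTop (show (0 : ℝ) < 1 / 6 by norm_num)).comp_tendsto
    tendsto_natCast_atTop_atTop).tendsto_div_nhds_zero
  refine tendsto_of_tendsto_of_tendsto_of_le_of_le' tendsto_const_nhds h
    (Eventually.of_forall fun n => by positivity) ?_
  filter_upwards [eventually_gt_atTop 0, (Real.tendsto_log_atTop.comp
    tendsto_natCast_atTop_atTop).eventually_ge_atTop 1] with n hn hlog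
  have hn' : (0 : ℝ) < n := by exact_mod_cast hn
  simp only [Function.comp_apply] at hlog ⊢
  have h1 : √√(Real.log n) ≤ Real.log n := by
    rw [Real.sqrt_le_left (by linarith), Real.sqrt_le_left (by positivity)]
    nlinarith [one_le_pow₀ (n := 3) hlog]
  have h2 : (n : ℝ) ^ (1 / 3 : ℝ) / √n = ((n : ℝ) ^ (1 / 6 : ℝ))⁻¹ := by
    rw [Real.sqrt_eq_rpow, ← Real.rpow_sub hn', ← Real.rpow_neg hn'.le]
    norm_num
  rw [mul_div_left_comm, h2, div_eq_mul_inv]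
  exact mul_le_mul_of_nonneg_right h1 (by positivity)

section Comparison

variable {𝒟 Ω : Type*} [MeasurableSpace 𝒟] [MeasurableSpace Ω] {μ : Measure Ω}
  [IsProbabilityMeasure μ] {P : Measure 𝒟} [IsProbabilityMeasure P] {D : ℕ → Ω → 𝒟} {p L : ℕ}
  {g : 𝒟 → EuclideanSpace ℝ (Fin p) → EuclideanSpace ℝ (Fin L)}
  {γhat : ℕ → Ω → EuclideanSpace ℝ (Fin p)}

/-- The criterion of the true model exceeds its penalty by less than `log n`, the penalty of one
further parameter. -/
theorem Regular.eventually_whp_elcic_lt (hD : ∀ i, HasLaw (D i) P μ) (hind : iIndepFun D μ)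
    (hg : Measurable (Function.uncurry g)) {γ₀ : EuclideanSpace ℝ (Fin p)}
    (hreg : Regular P g γ₀)
    (hroot : BoundedInProbability μ fun n ω => √(n : ℝ) * ‖γhat n ω - γ₀‖) :
    ∀ᶠ z in whp μ, elcic p (fun i : Fin z.1 => g (D i z.2) (γhat z.1 z.2)) <
      (((p + 1) * Real.log z.1 : ℝ) : EReal) := by
  obtain ⟨K, hK⟩ := hreg.exists_eventually_whp_isMultiplier hD hind hg hroot
    tendsto_sqrt_sqrt_log tendsto_rpow_mul_sqrt_sqrt_log_div_sqrt
  have hev : ∀ᶠ n : ℕ in atTop, max 0 (2 * K) < √(Real.log n) :=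
    (Real.tendsto_sqrt_atTop.comp (Real.tendsto_log_atTop.comp
      tendsto_natCast_atTop_atTop)).eventually_gt_atTop _
  filter_upwards [hK, eventually_whp_of_atTop hev] with z ⟨lam, hlam, hle⟩ hlog
  rw [elcic_eq p hlam, EReal.coe_lt_coe_iff, log_elRatio hlam.1]
  have h0 : 0 < √(Real.log z.1) := (le_max_left _ _).trans_lt hlog
  have h1 : 2 * K < √(Real.log z.1) := (le_max_right _ _).trans_lt hlog
  have h2 : √(Real.log z.1) * √(Real.log z.1) = Real.log z.1 :=
    Real.mul_self_sqrt (Real.sqrt_pos.1 h0).le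
  rw [Real.sq_sqrt h0.le] at hle
  nlinarith

theorem MisspecifiedRegular.eventually_whp_lt_elcic (hD : ∀ i, HasLaw (D i) P μ)
    (hind : iIndepFun D μ) (hg : Measurable (Function.uncurry g))
    {γs : EuclideanSpace ℝ (Fin p)} (hmis : MisspecifiedRegular P g γs)
    (hid : Identifiable P g γs) (hγ : TendstoInMeasure μ γhat atTop fun _ => γs) (C : ℝ) :
    ∀ᶠ z in whp μ, ((C * Real.log z.1 : ℝ) : EReal) <
      elcic p (fun i : Fin z.1 => g (D i z.2) (γhat z.1 z.2)) := by
  filter_upwards [hmis.eventually_whp_mul_log_lt hD hind hg hid hγ (C / 2)] with z ⟨ν, hν, hlt⟩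
  refine lt_of_lt_of_le (EReal.coe_lt_coe_iff.2 ?_) (le_elcic p hν)
  have : 0 ≤ p * Real.log z.1 := mul_nonneg p.cast_nonneg (Real.log_natCast_nonneg _)
  linarith

end Comparison

end ELCIC

theorem theorem4
    {Ω 𝒟 ι : Type*} [MeasurableSpace Ω] [MeasurableSpace 𝒟] [Finite ι]
    (μ : Measure Ω) [IsProbabilityMeasure μ] (P : Measure 𝒟) [IsProbabilityMeasure P]
    -- the data: independent, with common law `P`
    (D : ℕ → Ω → 𝒟) (hD_law : ∀ i, HasLaw (D i) P μ) (hD_indep : iIndepFun D μ)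
    -- the candidate models: number of parameters, estimating functions, plug-in estimators
    (L : ℕ) (p : ι → ℕ)
    (g : (M : ι) → 𝒟 → EuclideanSpace ℝ (Fin (p M)) → EuclideanSpace ℝ (Fin L))
    (hg : ∀ M, Measurable (Function.uncurry (g M)))
    (γhat : (M : ι) → ℕ → Ω → EuclideanSpace ℝ (Fin (p M)))
    (hγhat : ∀ M n, Measurable (γhat M n))
    -- the true model, with its true parameter
    (M₀ : ι) (γ₀ : EuclideanSpace ℝ (Fin (p M₀)))
    (hreg : ELCIC.Regular P (g M₀) γ₀)
    (hest : ELCIC.WellBehaved P μ (g M₀) γ₀ D (γhat M₀))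
    -- any other candidate is misspecified, or correctly specified with more parameters
    (hother : ∀ M, M ≠ M₀ →
      (∃ γs : EuclideanSpace ℝ (Fin (p M)),
        TendstoInMeasure μ (γhat M) atTop (fun _ => γs) ∧
        ELCIC.MisspecifiedRegular P (g M) γs ∧ ELCIC.Identifiable P (g M) γs) ∨
      (ELCIC.CorrectlySpecified P (g M) ∧ p M₀ < p M)) :
    Tendsto
      (fun n : ℕ => μ {ω | ∀ M, M ≠ M₀ →
        ELCIC.elcic (p M₀) (fun i : Fin n => g M₀ (D i ω) (γhat M₀ n ω)) <
          ELCIC.elcic (p M) (fun i : Fin n => g M (D i ω) (γhat M n ω))})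
      atTop (𝓝 1) := by
  have htrue := hreg.eventually_whp_elcic_lt hD_law hD_indep (hg M₀) hest.root_n
  refine ELCIC.tendsto_measure_one_of_eventually_whp (p := fun z => ∀ M, M ≠ M₀ →
    ELCIC.elcic (p M₀) (fun i : Fin z.1 => g M₀ (D i z.2) (γhat M₀ z.1 z.2)) <
      ELCIC.elcic (p M) (fun i : Fin z.1 => g M (D i z.2) (γhat M z.1 z.2)))
    (eventually_all.2 fun M => ?_)
  by_cases hM : M = M₀
  · exact Eventually.of_forall fun z h => absurd hM h
  rcases hother M hM with ⟨γs, hγ, hmis, hid⟩ | ⟨-, hlt⟩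
  · filter_upwards [htrue, hmis.eventually_whp_lt_elcic hD_law hD_indep (hg M) hid hγ
      (p M₀ + 1)] with z h1 h2 _
    exact h1.trans h2
  · filter_upwards [htrue] with z h1 _
    refine h1.trans_le (le_trans (EReal.coe_le_coe_iff.2 ?_) (ELCIC.mul_log_le_elcic _ _))
    have : (p M₀ : ℝ) + 1 ≤ p M := by exact_mod_cast hlt
    gcongr
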